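/- Let $n\ge 1$. All vector spaces are over $\mathbb{C}$. A LA$n$Ke (Lie algebra of the $n$-th kind) is a vector space with an $n$-linear bracket that is antisymmetric, $[x_1,\dots,x_n]=\operatorname{sgn}(\sigma)[x_{\sigma(1)},\dots,x_{\sigma(n)}]$ for all $\sigma\in S_n$, and satisfies the generalized Jacobi identity $$[[x_1,\dots,x_n],y_1,\dots,y_{n-1}]=\sum_{i=1}^n(-1)^{n-i}\,[[y_1,\dots,y_{n-1},x_i],x_1,\dots,\widehat{x_i},\dots,x_n].$$ Let $\mathcal L$ be the free LA$n$Ke on the generators $1,2,\dots,2n-1$, and let $\rho_{n,3}\subseteq\mathcal L$ be the subspace spanned by the $n$-bracketed words with exactly two brackets in which each generator appears exactly once (for $n\ge 2$, a word in which each of the $2n-1$ generators appears exactly once automatically has two brackets). Call a bracket $[[x_1,\dots,x_n],y_1,\dots,y_{n-1}]$, where $x_1,\dots,x_n,y_1,\dots,y_{n-1}$ are the generators $1,\dots,2n-1$ in some order, standard if $x_1<x_2<\dots<x_n$, $y_1<y_2<\dots<y_{n-1}$ and $x_j<y_j$ for every $j\in\{1,\dots,n-1\}$. Then the standard brackets are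 pairwise distinct as elements of $\mathcal L$ and form a basis of $\rho_{n,3}$. Moreover, sending $[[x_1,\dots,x_n],y_1,\dots,y_{n-1}]$ to the tableau whose first column is $x_1,\dots,x_n$ and whose second column is $y_1,\dots,y_{n-1}$ (read from top to bottom) defines a bijection from the standard brackets to the standard Young tableaux of shape $2^{n-1}1$, that is, with $n-1$ rows of length $2$ followed by one row of length $1$. -/

import Mathlib

noncomputable section

namespace LieNth

open Module

/-- A Lie algebra of the `n`-th kind over `ℂ` (a LAnKe), where `n = m + 1`: a complex vector space
with an `n`-linear bracket which is antisymmetric and satisfies the generalized Jacobi identity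
`[[x₁,…,xₙ],y₁,…,yₙ₋₁] = ∑ᵢ (-1)^(n-i) [[y₁,…,yₙ₋₁,xᵢ],x₁,…,x̂ᵢ,…,xₙ]`.
The indices below are counted from `0`, so that the exponent `n - i` is `m - i`. -/
class LAnKe (m : ℕ) (L : Type*) [AddCommGroup L] [Module ℂ L] where
  /-- the `n`-linear bracket -/
  bracket : MultilinearMap ℂ (fun _ : Fin (m + 1) => L) L
  antisymm : ∀ (σ : Equiv.Perm (Fin (m + 1))) (x : Fin (m + 1) → L),
    bracket x = ((Equiv.Perm.sign σ : ℤ) : ℂ) • bracket (fun i => x (σ i))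
  jacobi : ∀ (x : Fin (m + 1) → L) (y : Fin m → L),
    bracket (Fin.cons (bracket x) y : Fin (m + 1) → L) =
      ∑ i : Fin (m + 1), (-1 : ℂ) ^ (m - (i : ℕ)) •
        bracket (Fin.cons (bracket (Fin.snoc y (x i) : Fin (m + 1) → L))
          (fun j => x (i.succAbove j)) : Fin (m + 1) → L)

/-! ### The free LAnKe -/

/-- Formal `n`-bracketed words in the elements of `X`, where `n = m + 1`. -/
inductive Word (m : ℕ) (X : Type*) where
  | gen (a : X) : Word m X
  | node (w : Fin (m + 1) → Word m X) : Word m X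

namespace Word

variable {m : ℕ} {X : Type*}

/-- The number of occurrences of the generator `a` in a word. -/
def count [DecidableEq X] (a : X) : Word m X → ℕ
  | gen b => if b = a then 1 else 0
  | node w => ∑ i, count a (w i)

/-- The number of brackets in a word. -/
def brackets : Word m X → ℕ
  | gen _ => 0
  | node w => 1 + ∑ i, brackets (w i)

/-- The value of a bracketed word in a LAnKe in which the generators have been given values. -/
def eval {K : Type*} [AddCommGroup K] [Module ℂ K] [LAnKe m K] (f : X → K) : Word m X → K
  | gen a => f a
  | node w => LAnKe.bracket (fun i => eval f (w i))

end Word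

/-- The bracket on the vector space with basis all `n`-bracketed words: the `n`-linear extension of
the bracketing of words (no relation is imposed yet). -/
def wordBracket (m : ℕ) (X : Type*) :
    MultilinearMap ℂ (fun _ : Fin (m + 1) => Word m X →₀ ℂ) (Word m X →₀ ℂ) :=
  ((Basis.piTensorProduct (fun _ : Fin (m + 1) =>
      (Finsupp.basisSingleOne : Basis (Word m X) ℂ (Word m X →₀ ℂ)))).constr ℂ
    (fun w => Finsupp.single (Word.node w) (1 : ℂ))).compMultilinearMap (PiTensorProduct.tprod ℂ)

theorem wordBracket_single (m : ℕ) (X : Type*) (w : Fin (m + 1) → Word m X) :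
    wordBracket m X (fun i => Finsupp.single (w i) 1) = Finsupp.single (Word.node w) 1 := by
  have h := Basis.piTensorProduct_apply (fun _ : Fin (m + 1) =>
      (Finsupp.basisSingleOne : Basis (Word m X) ℂ (Word m X →₀ ℂ))) w
  simp only [Finsupp.coe_basisSingleOne] at h
  simp only [wordBracket, LinearMap.compMultilinearMap_apply]
  rw [← h, Basis.constr_basis]

/-- The elements which have to vanish in the free LAnKe: all instances of antisymmetry and of the
generalized Jacobi identity, and all brackets with such an element as one of their entries. -/
inductive Rel (m : ℕ) (X : Type*) : (Word m X →₀ ℂ) → Prop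
  | antisymm (σ : Equiv.Perm (Fin (m + 1))) (x : Fin (m + 1) → Word m X →₀ ℂ) :
      Rel m X (wordBracket m X x -
        ((Equiv.Perm.sign σ : ℤ) : ℂ) • wordBracket m X (fun i => x (σ i)))
  | jacobi (x : Fin (m + 1) → Word m X →₀ ℂ) (y : Fin m → Word m X →₀ ℂ) :
      Rel m X (wordBracket m X (Fin.cons (wordBracket m X x) y : Fin (m + 1) → Word m X →₀ ℂ) -
        ∑ i : Fin (m + 1), (-1 : ℂ) ^ (m - (i : ℕ)) •
          wordBracket m X
            (Fin.cons (wordBracket m X (Fin.snoc y (x i) : Fin (m + 1) → Word m X →₀ ℂ))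
              (fun j => x (i.succAbove j)) : Fin (m + 1) → Word m X →₀ ℂ))
  | bracket (x : Fin (m + 1) → Word m X →₀ ℂ) (i : Fin (m + 1)) (h : Rel m X (x i)) :
      Rel m X (wordBracket m X x)

/-- The ideal of relations of the free LAnKe. -/
def relIdeal (m : ℕ) (X : Type*) : Submodule ℂ (Word m X →₀ ℂ) :=
  Submodule.span ℂ {r | Rel m X r}

/-- The free LAnKe on `X` (for `n = m + 1`), over `ℂ`: the space spanned by all `n`-bracketed words
in `X`, subject to antisymmetry and the generalized Jacobi identity. -/
abbrev FreeLAnKe (m : ℕ) (X : Type*) : Type _ := (Word m X →₀ ℂ) ⧸ relIdeal m X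

theorem wordBracket_mem (m : ℕ) (X : Type*) (x : Fin (m + 1) → Word m X →₀ ℂ) (i : Fin (m + 1))
    (h : x i ∈ relIdeal m X) : wordBracket m X x ∈ relIdeal m X := by
  have key : relIdeal m X ≤
      (relIdeal m X).comap ((wordBracket m X).toLinearMap x i) := by
    refine Submodule.span_le.2 fun r hr => Submodule.subset_span ?_
    refine Rel.bracket _ i ?_
    simpa using hr
  simpa using key h

theorem wordBracket_congr (m : ℕ) (X : Type*) (x y : Fin (m + 1) → Word m X →₀ ℂ)
    (h : ∀ i, x i - y i ∈ relIdeal m X) :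
    wordBracket m X x - wordBracket m X y ∈ relIdeal m X := by
  classical
  have hx : x = y + (fun i => x i - y i) := by
    ext1 i
    simp
  have hs := (wordBracket m X).map_add_univ y (fun i => x i - y i)
  rw [← hx, ← Finset.add_sum_erase _ _ (Finset.mem_univ Finset.univ)] at hs
  rw [hs]
  simp only [Finset.piecewise_univ, add_sub_cancel_left]
  refine Submodule.sum_mem _ fun s hs => ?_
  obtain ⟨i, hi⟩ : ∃ i, i ∉ s := by
    by_contra! hc
    exact (Finset.mem_erase.1 hs).1 (Finset.eq_univ_iff_forall.2 hc)
  refine wordBracket_mem m X _ i ?_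
  rw [Finset.piecewise_eq_of_notMem _ _ _ hi]
  exact h i

theorem exists_section (m : ℕ) (X : Type*) : ∃ s : FreeLAnKe m X →ₗ[ℂ] (Word m X →₀ ℂ),
    (relIdeal m X).mkQ ∘ₗ s = LinearMap.id :=
  LinearMap.exists_rightInverse_of_surjective _ (Submodule.range_mkQ _)

/-- The bracket of the free LAnKe, computed on representatives. The value does not depend on them:
see `freeBracket_mk`. -/
def freeBracket (m : ℕ) (X : Type*) :
    MultilinearMap ℂ (fun _ : Fin (m + 1) => FreeLAnKe m X) (FreeLAnKe m X) :=
  (relIdeal m X).mkQ.compMultilinearMap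
    ((wordBracket m X).compLinearMap (fun _ => (exists_section m X).choose))

theorem freeBracket_mk (m : ℕ) (X : Type*) (x : Fin (m + 1) → Word m X →₀ ℂ) :
    freeBracket m X (fun i => (relIdeal m X).mkQ (x i)) =
      (relIdeal m X).mkQ (wordBracket m X x) := by
  simp only [freeBracket, LinearMap.compMultilinearMap_apply, MultilinearMap.compLinearMap_apply]
  rw [← sub_eq_zero, ← map_sub, Submodule.mkQ_apply, Submodule.Quotient.mk_eq_zero]
  refine wordBracket_congr m X _ _ fun i => ?_
  rw [← Submodule.Quotient.mk_eq_zero, ← Submodule.mkQ_apply, map_sub, sub_eq_zero]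
  exact LinearMap.congr_fun (exists_section m X).choose_spec _

theorem cons_mk {m : ℕ} {X : Type*} (a : Word m X →₀ ℂ) (y : Fin m → Word m X →₀ ℂ) :
    (Fin.cons ((relIdeal m X).mkQ a) (fun j => (relIdeal m X).mkQ (y j)) :
      Fin (m + 1) → FreeLAnKe m X) =
    fun i => (relIdeal m X).mkQ ((Fin.cons a y : Fin (m + 1) → Word m X →₀ ℂ) i) := by
  ext1 i
  refine Fin.cases ?_ (fun j => ?_) i <;> simp

theorem snoc_mk {m : ℕ} {X : Type*} (a : Word m X →₀ ℂ) (y : Fin m → Word m X →₀ ℂ) :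
    (Fin.snoc (fun j => (relIdeal m X).mkQ (y j)) ((relIdeal m X).mkQ a) :
      Fin (m + 1) → FreeLAnKe m X) =
    fun i => (relIdeal m X).mkQ ((Fin.snoc y a : Fin (m + 1) → Word m X →₀ ℂ) i) := by
  ext1 i
  refine Fin.lastCases ?_ (fun j => ?_) i <;> simp

instance instLAnKeFree (m : ℕ) (X : Type*) : LAnKe m (FreeLAnKe m X) where
  bracket := freeBracket m X
  antisymm σ x := by
    choose f hf using fun i => (relIdeal m X).mkQ_surjective (x i)
    obtain rfl : (fun i => (relIdeal m X).mkQ (f i)) = x := funext hf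
    rw [freeBracket_mk, freeBracket_mk m X (fun i => f (σ i)), ← map_smul, ← sub_eq_zero,
      ← map_sub, Submodule.mkQ_apply, Submodule.Quotient.mk_eq_zero]
    exact Submodule.subset_span (Rel.antisymm σ f)
  jacobi x y := by
    choose f hf using fun i => (relIdeal m X).mkQ_surjective (x i)
    obtain rfl : (fun i => (relIdeal m X).mkQ (f i)) = x := funext hf
    choose g hg using fun i => (relIdeal m X).mkQ_surjective (y i)
    obtain rfl : (fun i => (relIdeal m X).mkQ (g i)) = y := funext hg
    simp only [snoc_mk, freeBracket_mk]
    rw [cons_mk, freeBracket_mk]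
    have h2 : ∀ i : Fin (m + 1), freeBracket m X
        (Fin.cons ((relIdeal m X).mkQ
            (wordBracket m X (Fin.snoc g (f i) : Fin (m + 1) → Word m X →₀ ℂ)))
          (fun j => (relIdeal m X).mkQ (f (i.succAbove j))) : Fin (m + 1) → FreeLAnKe m X) =
        (relIdeal m X).mkQ (wordBracket m X
          (Fin.cons (wordBracket m X (Fin.snoc g (f i) : Fin (m + 1) → Word m X →₀ ℂ))
            (fun j => f (i.succAbove j)) : Fin (m + 1) → Word m X →₀ ℂ)) := fun i => by
      rw [cons_mk _ (fun j => f (i.succAbove j)), freeBracket_mk]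
    simp only [h2, ← map_smul]
    rw [← map_sum, ← sub_eq_zero, ← map_sub, Submodule.mkQ_apply, Submodule.Quotient.mk_eq_zero]
    exact Submodule.subset_span (Rel.jacobi f g)

/-- The inclusion of the generators in the free LAnKe. -/
def ι (m : ℕ) {X : Type*} (a : X) : FreeLAnKe m X :=
  (relIdeal m X).mkQ (Finsupp.single (Word.gen a) 1)

theorem eval_ι (m : ℕ) {X : Type*} (w : Word m X) :
    w.eval (ι m) = (relIdeal m X).mkQ (Finsupp.single w 1) := by
  induction w with
  | gen a => rfl
  | node w ih =>
    simp only [Word.eval, ih]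
    exact (freeBracket_mk m X _).trans (by rw [wordBracket_single])

theorem linearCombination_wordBracket {m : ℕ} {X K : Type*} [AddCommGroup K] [Module ℂ K]
    [LAnKe m K] (f : X → K) (x : Fin (m + 1) → Word m X →₀ ℂ) :
    Finsupp.linearCombination ℂ (Word.eval f) (wordBracket m X x) =
      LAnKe.bracket (fun i => Finsupp.linearCombination ℂ (Word.eval (m := m) f) (x i)) := by
  have h : (Finsupp.linearCombination ℂ (Word.eval f)).compMultilinearMap (wordBracket m X) =
      (LAnKe.bracket (m := m) (L := K)).compLinearMap
        (fun _ => Finsupp.linearCombination ℂ (Word.eval (m := m) f)) := by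
    refine Basis.ext_multilinear (fun _ => Finsupp.basisSingleOne) fun w => ?_
    simp [wordBracket_single, Word.eval]
  exact congrFun (congrArg DFunLike.coe h) x

/-- The universal property of the free LAnKe. -/
theorem existsUnique_lift {m : ℕ} {X K : Type*} [AddCommGroup K] [Module ℂ K] [LAnKe m K]
    (f : X → K) : ∃! F : FreeLAnKe m X →ₗ[ℂ] K,
      (∀ x : Fin (m + 1) → FreeLAnKe m X,
        F (LAnKe.bracket x) = LAnKe.bracket (fun i => F (x i))) ∧ ∀ a, F (ι m a) = f a := by
  set E := Finsupp.linearCombination ℂ (Word.eval (m := m) f) with hE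
  have hE' : ∀ x, E (wordBracket m X x) = LAnKe.bracket (fun i => E (x i)) :=
    linearCombination_wordBracket f
  have hc : ∀ (a : Word m X →₀ ℂ) (y : Fin m → Word m X →₀ ℂ),
      (fun i => E ((Fin.cons a y : Fin (m + 1) → Word m X →₀ ℂ) i)) =
        (Fin.cons (E a) (fun j => E (y j)) : Fin (m + 1) → K) := fun a y => by
    ext1 i
    refine Fin.cases ?_ (fun j => ?_) i <;> simp
  have hs : ∀ (a : Word m X →₀ ℂ) (y : Fin m → Word m X →₀ ℂ),
      (fun i => E ((Fin.snoc y a : Fin (m + 1) → Word m X →₀ ℂ) i)) =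
        (Fin.snoc (fun j => E (y j)) (E a) : Fin (m + 1) → K) := fun a y => by
    ext1 i
    refine Fin.lastCases ?_ (fun j => ?_) i <;> simp
  have hI : relIdeal m X ≤ LinearMap.ker E := by
    refine Submodule.span_le.2 fun r hr => ?_
    change E r = 0
    induction hr with
    | antisymm σ x =>
      rw [map_sub, map_smul, hE', hE', sub_eq_zero]
      exact LAnKe.antisymm σ _
    | jacobi x y =>
      simp only [map_sub, map_sum, map_smul, hE', hc, hs]
      rw [sub_eq_zero]
      exact LAnKe.jacobi _ _
    | bracket x i _ ih =>
      rw [hE']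
      exact MultilinearMap.map_coord_zero _ i ih
  refine ⟨(relIdeal m X).liftQ E hI, ⟨fun x => ?_, fun a => ?_⟩, fun G ⟨hG, hG'⟩ => ?_⟩
  · choose g hg using fun i => (relIdeal m X).mkQ_surjective (x i)
    obtain rfl : (fun i => (relIdeal m X).mkQ (g i)) = x := funext hg
    refine (congrArg _ (freeBracket_mk m X g)).trans ?_
    simp [hE']
  · simp [ι, hE, Word.eval]
  · have hw : ∀ w : Word m X, G (w.eval (ι m)) = w.eval f := fun w => by
      induction w with
      | gen a => exact hG' a
      | node w ih => simp only [Word.eval, hG, ih]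
    refine Submodule.linearMap_qext _ (Finsupp.lhom_ext' fun w => LinearMap.ext_ring ?_)
    have := hw w
    rw [eval_ι] at this
    simpa [hE] using this

/-! ### The multilinear component -/

/-- The multilinear component, involving `b` bracketings, of the free LAnKe on `X`: the span of the
`n`-bracketed words with `b` brackets in which each generator appears exactly once. (For `n ≥ 2` the
number of brackets is determined by the number of generators.) -/
def multilinearComponent (m : ℕ) (X : Type*) [DecidableEq X] (b : ℕ) :
    Submodule ℂ (FreeLAnKe m X) :=
  Submodule.span ℂ {v | ∃ w : Word m X, w.brackets = b ∧ (∀ a, w.count a = 1) ∧ v = w.eval (ι m)}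

/-- The space `ρ_{n,3}` for `n = m + 1`: the multilinear component, with two bracketings, of the
free LAnKe on `2n - 1 = 2m + 1` generators. -/
def rho3 (m : ℕ) : Submodule ℂ (FreeLAnKe m (Fin (2 * m + 1))) :=
  multilinearComponent m (Fin (2 * m + 1)) 2

/-- The bracket `[[x₁,…,xₙ],y₁,…,yₙ₋₁]` of generators. -/
def comb (m : ℕ) {X : Type*} (x : Fin (m + 1) → X) (y : Fin m → X) : FreeLAnKe m X :=
  LAnKe.bracket (Fin.cons (LAnKe.bracket (fun i => ι m (x i))) (fun j => ι m (y j)) :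
    Fin (m + 1) → FreeLAnKe m X)

/-- The bracket `[[x₁,…,xₙ],y₁,…,yₙ₋₁]`, in which each of the `2n - 1` generators appears exactly
once, is standard. -/
structure IsStandard (m : ℕ)
    (p : (Fin (m + 1) → Fin (2 * m + 1)) × (Fin m → Fin (2 * m + 1))) : Prop where
  each_once : Function.Bijective (Sum.elim p.1 p.2)
  inner_increasing : StrictMono p.1
  outer_increasing : StrictMono p.2
  inner_lt_outer : ∀ j : Fin m, p.1 j.castSucc < p.2 j

/-! ### Standard Young tableaux -/

/-- A filling of a Young diagram with the labels `0, …, N - 1` is a standard Young tableau if each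
label is used exactly once and the entries increase along rows and down columns. -/
structure IsStandardTableau (μ : YoungDiagram) {N : ℕ} (t : {c : ℕ × ℕ // c ∈ μ} → Fin N) :
    Prop where
  bijective : Function.Bijective t
  row_increasing : ∀ c d, c.1.1 = d.1.1 → c.1.2 < d.1.2 → t c < t d
  col_increasing : ∀ c d, c.1.2 = d.1.2 → c.1.1 < d.1.1 → t c < t d

/-- The shape `2^{n-1} 1` for `n = m + 1`: `m` rows of length two, then one row of length one. -/
def shape (m : ℕ) : YoungDiagram :=
  YoungDiagram.ofRowLens (List.replicate m 2 ++ [1]) (by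
    simp [List.sortedGE_iff_pairwise, List.pairwise_append, List.pairwise_replicate])

theorem mem_shape {m : ℕ} {c : ℕ × ℕ} :
    c ∈ shape m ↔ (c.2 = 0 ∧ c.1 < m + 1) ∨ (c.2 = 1 ∧ c.1 < m) := by
  rw [shape, YoungDiagram.mem_ofRowLens]
  simp only [List.length_append, List.length_replicate, List.length_singleton,
    List.getElem_append, List.getElem_replicate, List.getElem_singleton]
  constructor
  · rintro ⟨h1, h2⟩
    split_ifs at h2 <;> omega
  · rintro (⟨h1, h2⟩ | ⟨h1, h2⟩)
    · refine ⟨h2, ?_⟩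
      split_ifs <;> omega
    · refine ⟨by omega, ?_⟩
      split_ifs
      omega

/-- The tableau of shape `2^{n-1} 1` of the bracket `[[x₁,…,xₙ],y₁,…,yₙ₋₁]`: its first column is
`x₁,…,xₙ`, its second column is `y₁,…,yₙ₋₁`. -/
def tableau (m : ℕ) (p : (Fin (m + 1) → Fin (2 * m + 1)) × (Fin m → Fin (2 * m + 1)))
    (c : {c : ℕ × ℕ // c ∈ shape m}) : Fin (2 * m + 1) :=
  if h : c.1.2 = 0 then p.1 ⟨c.1.1, by have := mem_shape.1 c.2; omega⟩
  else p.2 ⟨c.1.1, by have := mem_shape.1 c.2; omega⟩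

end LieNth

end

/-! Independence comes from a small LAnKe `V ⊕ ℂ ⊕ ℂ` with `V = ℂⁿ`, graded in degrees 1, 2, 3. The
bracket of `n` vectors is their determinant, in degree 2. The bracket of a degree-2 scalar `c` with
`n - 1` vectors is `c` times the determinant of `e_n` (the last basis vector) followed by these
vectors, in degree 3. The Jacobi identity is the exchange identity for products of two determinants
(`detForm_exchange`). Sending each generator to the basis vector indexed by its row in a standard
array `q` gives a linear form on the free LAnKe that is nonzero at `q`. It vanishes at every other
standard `p` whose first column has sum at most that of `q` (`IsStandard.eq_of_row_injective`), so
the pairing is triangular.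

For spanning, a sign makes the bracket a function `w` of the set `T` of outer entries alone, and
Jacobi becomes `w T = ± ∑ i ∈ Tᶜ, w (Tᶜ \ {i})`. A double count shows that the sum of `w` over all
`m`-sets (`m = n - 1`) containing `U` and avoiding `D` vanishes whenever `|U| + |D| < m`
(`starSum_eq_zero`). These are Garnir-type relations: at a violation of the row condition, one of
them expresses `w T` by sets with larger sum of entries (`straightening`).

The tableau statement only translates the order conditions cell by cell. -/

namespace LieNth

/-! ### The determinantal LAnKe. -/

/-- The last vector of the standard basis. -/
def lastVec (m : ℕ) : Fin (m + 1) → ℂ := Pi.single (Fin.last m) 1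

/-- The determinant as an alternating form of the rows. -/
abbrev detForm (m : ℕ) : (Fin (m + 1) → ℂ) [⋀^Fin (m + 1)]→ₗ[ℂ] ℂ := Matrix.detRowAlternating

/-- Cramer's rule, in a form that needs no invertibility. -/
theorem detForm_smul_eq_sum {m : ℕ} (x : Fin (m + 1) → Fin (m + 1) → ℂ) (e : Fin (m + 1) → ℂ) :
    detForm m x • e = ∑ i, detForm m (Function.update x i e) • x i := by
  have h := Matrix.mulVec_cramer (Matrix.transpose (Matrix.of x)) e
  have h2 : Matrix.det (Matrix.transpose (Matrix.of x)) = detForm m x := Matrix.det_transpose _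
  rw [h2] at h
  rw [← h]
  ext k
  simp only [Matrix.mulVec, dotProduct, Matrix.cramer_transpose_apply, Finset.sum_apply,
    Pi.smul_apply, smul_eq_mul]
  exact Finset.sum_congr rfl fun i _ => mul_comm _ _

/-- Applying the linear form `v ↦ det (v, y)` to Cramer's rule gives the identity up to the
positions of `e` and `x i`. Moving them costs `(-1) ^ i` and `(-1) ^ m`, whose product is the Jacobi
sign `(-1) ^ (m - i)`. -/
theorem detForm_exchange {m : ℕ} (x : Fin (m + 1) → Fin (m + 1) → ℂ) (e : Fin (m + 1) → ℂ)
    (y : Fin m → Fin (m + 1) → ℂ) :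
    detForm m x * detForm m (Fin.cons e y) = ∑ i : Fin (m + 1), (-1 : ℂ) ^ (m - (i : ℕ)) *
      (detForm m (Fin.snoc y (x i)) * detForm m (Fin.cons e (fun j => x (i.succAbove j)))) := by
  have hlin : ∀ v : Fin (m + 1) → ℂ, detForm m (Fin.cons v y) =
      (detForm m).toMultilinearMap.toLinearMap (Fin.cons 0 y) 0 v := fun v => by
    simp [Fin.update_cons_zero]
  have h1 : detForm m x * detForm m (Fin.cons e y) =
      ∑ i, detForm m (Function.update x i e) * detForm m (Fin.cons (x i) y) := by
    rw [hlin e, ← smul_eq_mul, ← map_smul, detForm_smul_eq_sum, map_sum]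
    exact Finset.sum_congr rfl fun i _ => by rw [map_smul, hlin, smul_eq_mul]
  rw [h1]
  refine Finset.sum_congr rfl fun i _ => ?_
  have h2 : detForm m (Fin.snoc y (x i)) = (-1) ^ m * detForm m (Fin.cons (x i) y) := by
    have := (detForm m).map_insertNth (Fin.last m) (x i) y
    rw [Fin.insertNth_last'] at this
    rw [this]
    simp [Matrix.vecCons]
  have h3 : detForm m (Function.update x i e) =
      (-1) ^ (i : ℕ) * detForm m (Fin.cons e (fun j => x (i.succAbove j))) := by
    have := (detForm m).map_insertNth i e (fun j => x (i.succAbove j))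
    rw [show i.insertNth e (fun j => x (i.succAbove j)) = Function.update x i e from
      Fin.insertNth_removeNth i e x] at this
    rw [this]
    simp [Matrix.vecCons]
  rw [h2, h3]
  have h4 : (-1 : ℂ) ^ (m - (i : ℕ)) * (-1) ^ m = (-1) ^ (i : ℕ) := by
    rw [← pow_add, show m - (i : ℕ) + m = i + 2 * (m - i) by omega, pow_add, pow_mul]
    simp
  linear_combination (-(detForm m (Fin.cons (x i) y)) *
    detForm m (Fin.cons e (fun j => x (i.succAbove j)))) * h4

/-- The rows of which `bracketTop` takes the determinants. -/
def markedRow (m : ℕ) (i j : Fin (m + 1)) :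
    ((Fin (m + 1) → ℂ) × ℂ × ℂ) →ₗ[ℂ] (Fin (m + 1) → ℂ) :=
  if j = i then (LinearMap.toSpanSingleton ℂ _ (lastVec m)) ∘ₗ LinearMap.fst ℂ ℂ ℂ ∘ₗ
    LinearMap.snd ℂ _ _ else LinearMap.fst ℂ _ _

/-- The component of degree three of the bracket of the determinantal LAnKe. -/
def bracketTop (m : ℕ) :
    MultilinearMap ℂ (fun _ : Fin (m + 1) => (Fin (m + 1) → ℂ) × ℂ × ℂ) ℂ :=
  ∑ i, (detForm m).toMultilinearMap.compLinearMap (markedRow m i)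

/-- The bracket of the determinantal LAnKe. -/
def detBracket (m : ℕ) : MultilinearMap ℂ (fun _ : Fin (m + 1) => (Fin (m + 1) → ℂ) × ℂ × ℂ)
    ((Fin (m + 1) → ℂ) × ℂ × ℂ) :=
  MultilinearMap.prod 0 (MultilinearMap.prod
    ((detForm m).toMultilinearMap.compLinearMap (fun _ => LinearMap.fst ℂ _ _)) (bracketTop m))

theorem detBracket_apply {m : ℕ} (z : Fin (m + 1) → (Fin (m + 1) → ℂ) × ℂ × ℂ) :
    detBracket m z = (0, detForm m (fun i => (z i).1),
      ∑ i, detForm m (fun j => markedRow m i j (z j))) := by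
  simp [detBracket, bracketTop]

theorem detBracket_cons {m : ℕ} (c d : ℂ) (y : Fin m → (Fin (m + 1) → ℂ) × ℂ × ℂ) :
    detBracket m (Fin.cons (0, c, d) y) =
      (0, 0, c * detForm m (Fin.cons (lastVec m) (fun j => (y j).1))) := by
  rw [detBracket_apply]
  refine Prod.ext rfl (Prod.ext ?_ ?_)
  · exact (detForm m).map_coord_zero 0 rfl
  · simp only
    -- Only the term marking position `0` survives: in the others, row `0` is the degree-one part of
    -- the first entry, which is zero.
    rw [Fin.sum_univ_succ, Finset.sum_eq_zero (fun i _ => ?_), add_zero]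
    · have : (fun j => markedRow m 0 j ((Fin.cons (0, c, d) y : Fin (m + 1) → _) j)) =
          Function.update (Fin.cons (lastVec m) (fun j => (y j).1)) 0 (c • lastVec m) := by
        ext1 j
        refine Fin.cases ?_ (fun k => ?_) j
        · simp [markedRow]
        · simp [markedRow]
      rw [this, AlternatingMap.map_update_smul, smul_eq_mul]
      simp
    · refine (detForm m).map_coord_zero 0 ?_
      simp [markedRow, (Fin.succ_ne_zero i).symm]

theorem detBracket_cons_detBracket {m : ℕ} (x : Fin (m + 1) → (Fin (m + 1) → ℂ) × ℂ × ℂ)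
    (y : Fin m → (Fin (m + 1) → ℂ) × ℂ × ℂ) :
    detBracket m (Fin.cons (detBracket m x) y) = (0, 0, detForm m (fun i => (x i).1) *
      detForm m (Fin.cons (lastVec m) (fun j => (y j).1))) := by
  rw [detBracket_apply x]
  exact detBracket_cons _ _ y

/-- The determinantal LAnKe, with components in degrees one, two and three. -/
instance detLAnKe (m : ℕ) : LAnKe m ((Fin (m + 1) → ℂ) × ℂ × ℂ) where
  bracket := detBracket m
  antisymm σ x := by
    have key : ∀ z : Fin (m + 1) → Fin (m + 1) → ℂ,
        detForm m z = ((Equiv.Perm.sign σ : ℤ) : ℂ) • detForm m (fun i => z (σ i)) := fun z => by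
      have h := (detForm m).map_perm z σ
      rw [show (fun i => z (σ i)) = z ∘ σ from rfl, h]
      rcases Int.units_eq_one_or (Equiv.Perm.sign σ) with h | h <;> simp [h]
    rw [detBracket_apply, detBracket_apply]
    refine Prod.ext (by simp) (Prod.ext (key _) ?_)
    simp only [Prod.smul_mk, Finset.smul_sum]
    -- The marked position moves along with the entries: marking `σ i` before permuting is marking
    -- `i` afterwards.
    rw [← Equiv.sum_comp σ]
    refine Finset.sum_congr rfl fun i _ => ?_
    rw [key]
    simp [markedRow]
  jacobi x y := by
    have hs : ∀ i, detBracket m (Fin.cons (detBracket m (Fin.snoc y (x i)))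
        (fun j => x (i.succAbove j))) =
        (0, 0, detForm m (Fin.snoc (fun j => (y j).1) (x i).1) *
          detForm m (Fin.cons (lastVec m) (fun j => (x (i.succAbove j)).1))) := fun i => by
      rw [detBracket_cons_detBracket]
      congr 4
      ext1 j
      refine Fin.lastCases ?_ (fun k => ?_) j <;> simp
    simp only [hs]
    rw [detBracket_cons_detBracket, detForm_exchange]
    simp [Prod.ext_iff, Prod.fst_sum, Prod.snd_sum]

theorem detForm_single_ne_zero_iff {m : ℕ} (g : Fin (m + 1) → Fin (m + 1)) :
    detForm m (fun i => Pi.single (g i) 1) ≠ 0 ↔ Function.Injective g := by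
  constructor
  · intro h i j hij
    by_contra hne
    exact h ((detForm m).map_eq_zero_of_eq _ (by simp [hij]) hne)
  · intro h
    have h2 := (detForm m).map_perm (fun i => Pi.single i 1)
      (Equiv.ofBijective g (Finite.injective_iff_bijective.1 h))
    have h3 : detForm m (fun i => Pi.single i 1) = 1 := by
      have : (fun i => Pi.single i 1 : Fin (m + 1) → Fin (m + 1) → ℂ) =
          (1 : Matrix (Fin (m + 1)) (Fin (m + 1)) ℂ) := by
        ext i j
        simp [Matrix.one_apply, Pi.single_apply, eq_comm]
      rw [this]
      exact Matrix.det_one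
    rw [h3] at h2
    change detForm m (fun i => Pi.single (g i) 1) = _ at h2
    rw [h2]
    rcases Int.units_eq_one_or (Equiv.Perm.sign
      (Equiv.ofBijective g (Finite.injective_iff_bijective.1 h))) with h | h <;> simp [h]

/-- A linear form on the free LAnKe obtained by assigning a row to each generator. -/
theorem exists_rowForm {m : ℕ} {X : Type*} (r : X → Fin (m + 1)) :
    ∃ φ : FreeLAnKe m X →ₗ[ℂ] ℂ, ∀ x y, φ (comb m x y) ≠ 0 ↔
      Function.Injective (fun i => r (x i)) ∧
      Function.Injective (Fin.cons (Fin.last m) (fun j => r (y j)) : Fin (m + 1) → Fin (m + 1)) := by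
  obtain ⟨F, ⟨hF, hf⟩, -⟩ := existsUnique_lift (m := m)
    (fun a : X => ((Pi.single (r a) 1, 0, 0) : (Fin (m + 1) → ℂ) × ℂ × ℂ))
  refine ⟨LinearMap.snd ℂ _ _ ∘ₗ LinearMap.snd ℂ _ _ ∘ₗ F, fun x y => ?_⟩
  have h1 : F (comb m x y) = detBracket m (Fin.cons
      (detBracket m fun i => (Pi.single (r (x i)) 1, 0, 0))
      (fun j => (Pi.single (r (y j)) 1, 0, 0))) := by
    rw [comb, hF]
    refine congrArg (detBracket m) ?_
    ext1 j
    refine Fin.cases ?_ (fun k => ?_) j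
    · simp only [Fin.cons_zero, hF, hf]
      rfl
    · simp only [Fin.cons_succ, hf]
  rw [LinearMap.comp_apply, LinearMap.comp_apply, h1,
    detBracket_cons_detBracket]
  simp only [LinearMap.snd_apply]
  rw [mul_ne_zero_iff, detForm_single_ne_zero_iff, ← detForm_single_ne_zero_iff (Fin.cons _ _)]
  refine and_congr_right fun _ => not_congr ?_
  have : (Fin.cons (lastVec m) (fun j => Pi.single (r (y j)) 1) : Fin (m + 1) → Fin (m + 1) → ℂ) =
      fun i => Pi.single ((Fin.cons (Fin.last m) (fun j => r (y j)) : Fin (m + 1) → _) i) 1 := by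
    ext1 i
    refine Fin.cases ?_ (fun k => ?_) i <;> simp [lastVec]
  rw [this]

/-! ### Rows of standard arrays and linear independence. -/

/-- The row of a generator in the array of the bracket `p`. -/
noncomputable def IsStandard.row {m : ℕ} {p : (Fin (m + 1) → Fin (2 * m + 1)) × (Fin m → Fin (2 * m + 1))}
    (hp : IsStandard m p) (a : Fin (2 * m + 1)) : Fin (m + 1) :=
  Sum.elim id Fin.castSucc ((Equiv.ofBijective _ hp.each_once).symm a)

section Rows

variable {m : ℕ} {p q : (Fin (m + 1) → Fin (2 * m + 1)) × (Fin m → Fin (2 * m + 1))}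

theorem IsStandard.row_inner (hp : IsStandard m p) (i : Fin (m + 1)) : hp.row (p.1 i) = i := by
  have : (Equiv.ofBijective _ hp.each_once).symm (p.1 i) = Sum.inl i := by
    rw [Equiv.symm_apply_eq]; rfl
  rw [row, this]; rfl

theorem IsStandard.row_outer (hp : IsStandard m p) (j : Fin m) : hp.row (p.2 j) = j.castSucc := by
  have : (Equiv.ofBijective _ hp.each_once).symm (p.2 j) = Sum.inr j := by
    rw [Equiv.symm_apply_eq]; rfl
  rw [row, this]; rfl

theorem IsStandard.inner_row_le (hp : IsStandard m p) (a : Fin (2 * m + 1)) :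
    p.1 (hp.row a) ≤ a := by
  obtain ⟨i | j, rfl⟩ := hp.each_once.2 a
  · simp [hp.row_inner]
  · simpa [hp.row_outer] using (hp.inner_lt_outer j).le

theorem IsStandard.range_outer (hp : IsStandard m p) : Set.range p.2 = (Set.range p.1)ᶜ := by
  ext a
  constructor
  · rintro ⟨j, rfl⟩ ⟨i, hi⟩
    simpa using hp.each_once.1 (a₁ := Sum.inl i) (a₂ := Sum.inr j) hi
  · intro h
    obtain ⟨i | j, rfl⟩ := hp.each_once.2 a
    · exact absurd ⟨i, rfl⟩ h
    · exact ⟨j, rfl⟩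

theorem IsStandard.eq_of_inner_eq (hp : IsStandard m p) (hq : IsStandard m q) (h : p.1 = q.1) :
    p = q := by
  refine Prod.ext h ?_
  rw [← hp.outer_increasing.range_inj hq.outer_increasing, hp.range_outer, hq.range_outer, h]

/-- Each entry of the first column of `p` is at least the head of its row in `q`. By injectivity
every head is used once, so the inequality of sums forces equality termwise, and the two first
columns coincide as sets. -/
theorem IsStandard.eq_of_row_injective (hp : IsStandard m p) (hq : IsStandard m q)
    (hinj : Function.Injective (fun i => hq.row (p.1 i)))
    (hsum : ∑ i, (p.1 i : ℕ) ≤ ∑ i, (q.1 i : ℕ)) : p = q := by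
  set e := Equiv.ofBijective _ (Finite.injective_iff_bijective.1 hinj) with he
  have hle : ∀ i, (q.1 (e i) : ℕ) ≤ p.1 i := fun i => hq.inner_row_le (p.1 i)
  have hs : ∑ i, (q.1 (e i) : ℕ) = ∑ i, (p.1 i : ℕ) :=
    le_antisymm (Finset.sum_le_sum fun i _ => hle i) (by rwa [Equiv.sum_comp e (fun i => (q.1 i : ℕ))])
  have heq := (Finset.sum_eq_sum_iff_of_le fun i _ => hle i).1 hs
  refine hp.eq_of_inner_eq hq ?_
  rw [← hp.inner_increasing.range_inj hq.inner_increasing]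
  have : p.1 = q.1 ∘ e := funext fun i => Fin.ext (heq i (Finset.mem_univ i)).symm
  rw [this, e.surjective.range_comp]

theorem IsStandard.row_self (hp : IsStandard m p) :
    Function.Injective (fun i => hp.row (p.1 i)) ∧ Function.Injective
      (Fin.cons (Fin.last m) (fun j => hp.row (p.2 j)) : Fin (m + 1) → Fin (m + 1)) := by
  simp only [hp.row_inner, hp.row_outer]
  refine ⟨fun _ _ h => h, Fin.cons_injective_iff.2 ⟨?_, Fin.castSucc_injective m⟩⟩
  rintro ⟨j, hj⟩
  exact (Fin.castSucc_lt_last j).ne hj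

end Rows

theorem linearIndependent_comb (m : ℕ) :
    LinearIndependent ℂ (fun p : {p // IsStandard m p} => comb m p.1.1 p.1.2) := by
  rw [linearIndependent_iff']
  intro s g hg
  by_contra! hne
  -- With `q` of maximal first-column sum in the support of the relation, the form attached to the
  -- rows of `q` kills every other term.
  obtain ⟨q, hq, hmax⟩ := Finset.exists_max_image (s.filter (g · ≠ 0))
    (fun p => ∑ i, (p.1.1 i : ℕ)) (hne.imp fun i hi => Finset.mem_filter.2 hi)
  obtain ⟨hqs, hq0⟩ := Finset.mem_filter.1 hq
  obtain ⟨φ, hφ⟩ := exists_rowForm (m := m) q.2.row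
  have h := congrArg φ hg
  rw [map_sum, map_zero, Finset.sum_eq_single q] at h
  · rw [map_smul, smul_eq_mul, mul_eq_zero] at h
    exact h.elim hq0 ((hφ _ _).2 q.2.row_self)
  · intro p hp hpq
    rw [map_smul, smul_eq_mul]
    by_contra h0
    obtain ⟨h1, h2⟩ := mul_ne_zero_iff.1 h0
    refine hpq (Subtype.ext (p.2.eq_of_row_injective q.2 ((hφ _ _).1 h2).1 ?_))
    exact hmax p (Finset.mem_filter.2 ⟨hp, h1⟩)
  · exact fun h => absurd hqs h

/-! ### Vanishing sums derived from the exchange relation. -/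

section Exchange

variable {α M : Type*} [Fintype α] [DecidableEq α] [AddCommGroup M]

/-- The sum of `w` over the `m`-subsets which contain `U` and avoid `D`. -/
def starSum (m : ℕ) (w : Finset α → M) (U D : Finset α) : M :=
  ∑ T ∈ (Finset.powersetCard m Finset.univ).filter (fun T => U ⊆ T ∧ Disjoint D T), w T

theorem starSum_insert {m : ℕ} (w : Finset α → M) (U D : Finset α) (d : α) :
    starSum m w U D = starSum m w (insert d U) D + starSum m w U (insert d D) := by
  unfold starSum
  rw [← Finset.sum_filter_add_sum_filter_not _ (fun T => d ∈ T), Finset.filter_filter,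
    Finset.filter_filter]
  congr 1 <;> refine Finset.sum_congr (Finset.filter_congr fun T _ => ?_) fun _ _ => rfl
  · rw [Finset.insert_subset_iff]; tauto
  · rw [Finset.disjoint_insert_left]; tauto

variable [Module ℂ M]

/-- If the sums with fewer conditions vanish, turning one forbidden element into a required one only
changes the sign, by `starSum_insert`. -/
theorem starSum_of_lower {m k : ℕ} (w : Finset α → M)
    (h : ∀ U D : Finset α, U.card + D.card < k → starSum m w U D = 0) (D : Finset α) :
    ∀ U : Finset α, U.card + D.card ≤ k →
      starSum m w U D = (-1 : ℂ) ^ D.card • starSum m w (D ∪ U) ∅ := by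
  induction D using Finset.induction_on with
  | empty => intro U _; simp
  | insert d D hd ih =>
    intro U hU
    rw [Finset.card_insert_of_notMem hd] at hU ⊢
    have h1 := starSum_insert (m := m) w U D d
    rw [h U D (by omega), ih (insert d U) (by have := Finset.card_insert_le d U; omega)] at h1
    rw [Finset.insert_union, ← Finset.union_insert, pow_succ, mul_neg_one, neg_smul]
    exact (neg_eq_of_add_eq_zero_right h1.symm).symm

/-- Double count of pairs `(T, i)` with `i ∉ T` under the involution `(T, i) ↦ (Tᶜ \ {i}, i)`.
Containing `U` turns into avoiding `U` with `i ∉ U`, and each such set admits `m + 1 - |U|` choices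
of `i`. -/
theorem starSum_eq_of_exchange {m : ℕ} (hα : Fintype.card α = 2 * m + 1) (w : Finset α → M) (δ : ℂ)
    (hw : ∀ T : Finset α, T.card = m → w T = δ • ∑ i ∈ Tᶜ, w (Tᶜ.erase i))
    (U : Finset α) :
    starSum m w U ∅ = (δ * (m + 1 - U.card : ℕ)) • starSum m w ∅ U := by
  unfold starSum
  rw [Finset.sum_congr rfl fun T hT => hw T (by simp at hT; exact hT.1), ← Finset.smul_sum,
    mul_smul, Finset.smul_sum (r := ((m + 1 - U.card : ℕ) : ℂ))]
  congr 1
  have hc : ∀ T : Finset α, T.card = m → Tᶜ.card = m + 1 := fun T hT => by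
    rw [Finset.card_compl]; omega
  have hr : ∀ T ∈ (Finset.powersetCard m (Finset.univ : Finset α)).filter
      (fun T => ∅ ⊆ T ∧ Disjoint U T), ((m + 1 - U.card : ℕ) : ℂ) • w T =
        ∑ i ∈ Tᶜ \ U, w T := fun T hT => by
    simp only [Finset.mem_filter, Finset.mem_powersetCard, Finset.subset_univ, true_and,
      Finset.empty_subset] at hT
    rw [Finset.sum_const, Finset.card_sdiff_of_subset
      (Finset.subset_compl_iff_disjoint_right.2 hT.2), hc T hT.1, Nat.cast_smul_eq_nsmul]
  rw [Finset.sum_congr rfl hr, Finset.sum_sigma', Finset.sum_sigma']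
  refine Finset.sum_bij' (fun x _ => ⟨x.1ᶜ.erase x.2, x.2⟩) (fun x _ => ⟨x.1ᶜ.erase x.2, x.2⟩)
    ?_ ?_ ?_ ?_ ?_
  · rintro ⟨T, i⟩ h
    simp only [Finset.mem_sigma, Finset.mem_filter, Finset.mem_powersetCard, Finset.subset_univ,
      true_and, Finset.mem_compl, Finset.empty_subset, Finset.mem_sdiff] at h ⊢
    obtain ⟨⟨h1, h2, -⟩, h3⟩ := h
    refine ⟨⟨?_, ?_⟩, ?_, fun h => h3 (h2 h)⟩
    · rw [Finset.card_erase_of_mem (by simpa using h3), hc T h1]; rfl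
    · rw [Finset.disjoint_left]
      intro a ha hb
      simp only [Finset.mem_erase, Finset.mem_compl] at hb
      exact hb.2 (h2 ha)
    · simp
  · rintro ⟨T, i⟩ h
    simp only [Finset.mem_sigma, Finset.mem_filter, Finset.mem_powersetCard, Finset.subset_univ,
      true_and, Finset.mem_compl, Finset.empty_subset, Finset.mem_sdiff,
      Finset.disjoint_empty_left, and_true] at h ⊢
    obtain ⟨⟨h1, h2⟩, h3, h4⟩ := h
    refine ⟨⟨?_, ?_⟩, ?_⟩
    · rw [Finset.card_erase_of_mem (by simpa using h3), hc T h1]; rfl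
    · intro a ha
      simp only [Finset.mem_erase, Finset.mem_compl]
      exact ⟨fun h => h4 (h ▸ ha), Finset.disjoint_left.1 h2 ha⟩
    · simp
  · rintro ⟨T, i⟩ h
    simp only [Finset.mem_sigma, Finset.mem_compl] at h
    simp [Finset.compl_erase, h.2]
  · rintro ⟨T, i⟩ h
    simp only [Finset.mem_sigma, Finset.mem_compl, Finset.mem_sdiff] at h
    simp [Finset.compl_erase, h.2.1]
  · rintro ⟨T, i⟩ h
    rfl

theorem starSum_eq_zero {m : ℕ} (hα : Fintype.card α = 2 * m + 1) (w : Finset α → M) (δ : ℂ)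
    (hδ : δ = 1 ∨ δ = -1)
    (hw : ∀ T : Finset α, T.card = m → w T = δ • ∑ i ∈ Tᶜ, w (Tᶜ.erase i)) (k : ℕ) (hk : k ≤ m) :
    ∀ U D : Finset α, U.card + D.card < k → starSum m w U D = 0 := by
  induction k with
  | zero => intro U D h; omega
  | succ k ih =>
    intro U D h
    have ih := ih (by omega)
    rcases Nat.lt_succ_iff_lt_or_eq.1 h with h | h
    · exact ih U D h
    rw [starSum_of_lower w ih D U h.le]
    by_cases hlt : (D ∪ U).card < k
    · rw [ih _ _ (by simpa using hlt), smul_zero]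
    have hcard : (D ∪ U).card = k := by have := Finset.card_union_le D U; omega
    -- The sums requiring and forbidding `D ∪ U` are now related twice: by the factor `δ * (m + 1 -
    -- k)` and by `(-1) ^ k`. Since `k < m`, the integer `m + 1 - k = l + 2` is at least `2`, so the
    -- two relations together force both sums to vanish.
    have h1 := starSum_eq_of_exchange hα w δ hw (D ∪ U)
    rw [starSum_of_lower w ih (D ∪ U) ∅ (by simp [hcard]), smul_smul, Finset.union_empty,
      hcard] at h1
    obtain ⟨l, rfl⟩ : ∃ l, m = k + 1 + l := Nat.exists_eq_add_of_le hk
    rw [show k + 1 + l + 1 - k = l + 2 by omega] at h1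
    have h2 : (1 - δ * ((l + 2 : ℕ) : ℂ) * (-1) ^ k) • starSum (k + 1 + l) w (D ∪ U) ∅ = 0 := by
      rw [sub_smul, one_smul, ← h1, sub_self]
    have h3 : (1 - δ * ((l + 2 : ℕ) : ℂ) * (-1) ^ k) ≠ 0 := by
      have ha : ((l : ℂ) + 1) ≠ 0 := by exact_mod_cast Nat.succ_ne_zero l
      have hb : ((l : ℂ) + 3) ≠ 0 := by exact_mod_cast Nat.succ_ne_zero (l + 2)
      rcases hδ with rfl | rfl <;> rcases neg_one_pow_eq_or ℂ k with h | h <;> rw [h] <;>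
        push_cast <;> intro h0
      · exact ha (by linear_combination -h0)
      · exact hb (by linear_combination h0)
      · exact hb (by linear_combination h0)
      · exact ha (by linear_combination -h0)
    rw [(smul_eq_zero.1 h2).resolve_left h3, smul_zero]

end Exchange

/-! ### Straightening. -/

theorem sum_lt_of_exchange {T T' : Finset ℕ} (hc : T'.card = T.card) (hne : T' ≠ T) (c : ℕ)
    (h1 : ∀ a ∈ T, a ∉ T' → a ≤ c) (h2 : ∀ a ∈ T', a ∉ T → c < a) :
    ∑ a ∈ T, a < ∑ a ∈ T', a := by
  have hcard : (T \ T').card = (T' \ T).card := by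
    have ha := Finset.card_sdiff_add_card_inter T T'
    have hb := Finset.card_sdiff_add_card_inter T' T
    rw [Finset.inter_comm] at hb
    omega
  have hpos : 0 < (T' \ T).card := by
    rw [Finset.card_pos, Finset.sdiff_nonempty]
    exact fun h => hne (Finset.eq_of_subset_of_card_le h hc.ge)
  have ha := Finset.sum_inter_add_sum_sdiff T T' (fun a => a)
  have hb := Finset.sum_inter_add_sum_sdiff T' T (fun a => a)
  rw [Finset.inter_comm] at hb
  have hl := Finset.sum_le_card_nsmul (T \ T') (fun a => a) c
    (fun a h => h1 a (Finset.mem_sdiff.1 h).1 (Finset.mem_sdiff.1 h).2)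
  have hu := Finset.card_nsmul_le_sum (T' \ T) (fun a => a) (c + 1)
    (fun a h => h2 a (Finset.mem_sdiff.1 h).1 (Finset.mem_sdiff.1 h).2)
  rw [smul_eq_mul] at hl hu
  rw [hcard] at hl
  nlinarith

/-- Straightening: the exchange relation expresses all values of `w` by those at the sets of
entries of second columns of standard tableaux. -/
theorem straightening {m : ℕ} {M : Type*} [AddCommGroup M] [Module ℂ M]
    (w : Finset (Fin (2 * m + 1)) → M) (δ : ℂ) (hδ : δ = 1 ∨ δ = -1)
    (hw : ∀ T : Finset (Fin (2 * m + 1)), T.card = m → w T = δ • ∑ i ∈ Tᶜ, w (Tᶜ.erase i))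
    (S : Submodule ℂ M)
    (hS : ∀ p, IsStandard m p → w (Finset.univ.image p.2) ∈ S)
    (T : Finset (Fin (2 * m + 1))) (hT : T.card = m) : w T ∈ S := by
  have hbound : ∀ T : Finset (Fin (2 * m + 1)),
      ∑ a ∈ T, (a : ℕ) ≤ ∑ a : Fin (2 * m + 1), (a : ℕ) := fun T =>
    Finset.sum_le_sum_of_subset (Finset.subset_univ T)
  -- Straightening increases the sum of the outer entries, which is bounded; the induction is on the
  -- remaining gap.
  induction hN : (∑ a : Fin (2 * m + 1), (a : ℕ)) - ∑ a ∈ T, (a : ℕ)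
    using Nat.strong_induction_on generalizing T with
  | _ N ih =>
  have hTc : Tᶜ.card = m + 1 := by rw [Finset.card_compl, Fintype.card_fin]; omega
  set x := Tᶜ.orderEmbOfFin hTc with hx
  set y := T.orderEmbOfFin hT with hy
  have hxT : ∀ i, x i ∉ T := fun i => Finset.mem_compl.1 (Finset.orderEmbOfFin_mem _ hTc i)
  have hyT : ∀ j, y j ∈ T := fun j => Finset.orderEmbOfFin_mem _ hT j
  have hxr : ∀ a, a ∉ T → ∃ i, x i = a := fun a ha => by
    have := Finset.range_orderEmbOfFin Tᶜ hTc
    exact (Set.ext_iff.1 this a).2 (by simpa using ha)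
  have hyr : ∀ a ∈ T, ∃ j, y j = a := fun a ha => by
    have := Finset.range_orderEmbOfFin T hT
    exact (Set.ext_iff.1 this a).2 (by simpa using ha)
  by_cases hst : ∀ j : Fin m, x j.castSucc < y j
  · have := hS (x, y) ⟨⟨?_, ?_⟩, x.strictMono, y.strictMono, hst⟩
    · rwa [show Finset.univ.image (x, (y : Fin m → Fin (2 * m + 1))).2 = T from ?_] at this
      ext a
      simp only [Finset.mem_image, Finset.mem_univ, true_and]
      exact ⟨fun ⟨j, hj⟩ => hj ▸ hyT j, hyr a⟩
    · rintro (i | i) (j | j) h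
      · exact congrArg _ (x.injective h)
      · exact absurd (hyT j) ((show x i = y j from h) ▸ hxT i)
      · exact absurd (hyT i) ((show y i = x j from h) ▸ hxT j)
      · exact congrArg _ (y.injective h)
    · intro a
      by_cases ha : a ∈ T
      · obtain ⟨j, hj⟩ := hyr a ha
        exact ⟨Sum.inr j, hj⟩
      · obtain ⟨j, hj⟩ := hxr a ha
        exact ⟨Sum.inl j, hj⟩
  · push Not at hst
    obtain ⟨j, hj⟩ := hst
    have hlt : y j < x j.castSucc := lt_of_le_of_ne hj fun h => hxT j.castSucc (h ▸ hyT j)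
    -- Keep the outer entries below row `j` and forbid the inner ones above it: `(m - 1 - j) + j = m
    -- - 1` conditions. Any other set in this sum loses entries at most `y j` and gains entries at
    -- least `x j`, hence greater than `y j`.
    have hz := starSum_eq_zero (Fintype.card_fin _) w δ hδ hw m le_rfl
      ((Finset.Ioi j).map y.toEmbedding) ((Finset.Iio j.castSucc).map x.toEmbedding) (by
        rw [Finset.card_map, Finset.card_map, Fin.card_Ioi, Fin.card_Iio, Fin.val_castSucc]
        have := j.2
        omega)
    have hTmem : T ∈ (Finset.powersetCard m Finset.univ).filter (fun T' =>
        (Finset.Ioi j).map y.toEmbedding ⊆ T' ∧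
        Disjoint ((Finset.Iio j.castSucc).map x.toEmbedding) T') := by
      simp only [Finset.mem_filter, Finset.mem_powersetCard, Finset.subset_univ, true_and]
      refine ⟨hT, ?_, ?_⟩
      · intro a ha
        obtain ⟨k, -, rfl⟩ := Finset.mem_map.1 ha
        exact hyT k
      · rw [Finset.disjoint_left]
        intro a ha
        obtain ⟨k, -, rfl⟩ := Finset.mem_map.1 ha
        exact hxT k
    unfold starSum at hz
    rw [← Finset.add_sum_erase _ _ hTmem] at hz
    rw [eq_neg_of_add_eq_zero_left hz]
    refine S.neg_mem (S.sum_mem fun T' hT' => ?_)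
    simp only [Finset.mem_erase, Finset.mem_filter, Finset.mem_powersetCard, Finset.subset_univ,
      true_and] at hT'
    obtain ⟨hne, hcard, hU, hD⟩ := hT'
    have hsum : ∑ a ∈ T, (a : ℕ) < ∑ a ∈ T', (a : ℕ) := by
      have := sum_lt_of_exchange (T := T.map Fin.valEmbedding) (T' := T'.map Fin.valEmbedding)
        (by simp [hcard, hT]) (by simpa using hne) (y j) ?_ ?_
      · simpa using this
      · intro a ha ha'
        obtain ⟨b, hb, rfl⟩ := Finset.mem_map.1 ha
        obtain ⟨k, rfl⟩ := hyr b hb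
        have hk : y k ∉ T' := fun h => ha' (Finset.mem_map_of_mem _ h)
        refine y.monotone (not_lt.1 fun hjk => hk (hU ?_))
        exact Finset.mem_map_of_mem y.toEmbedding (Finset.mem_Ioi.2 hjk)
      · intro a ha ha'
        obtain ⟨b, hb, rfl⟩ := Finset.mem_map.1 ha
        obtain ⟨k, rfl⟩ := hxr b fun h => ha' (Finset.mem_map_of_mem _ h)
        refine lt_of_lt_of_le hlt (x.monotone (not_lt.1 fun hjk => ?_))
        exact Finset.disjoint_left.1 hD
          (Finset.mem_map_of_mem x.toEmbedding (Finset.mem_Iio.2 hjk)) hb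
    refine ih _ ?_ T' hcard rfl
    have := hbound T'
    omega

/-! ### Brackets as a function of the set of outer entries. -/

theorem int_sign_sq {α : Type*} [Fintype α] [DecidableEq α] (σ : Equiv.Perm α) :
    ((Equiv.Perm.sign σ : ℤ) : ℂ) * ((Equiv.Perm.sign σ : ℤ) : ℂ) = 1 := by
  rcases Int.units_eq_one_or (Equiv.Perm.sign σ) with h | h <;> simp [h]

theorem comb_perm {m : ℕ} {X : Type*} (σ : Equiv.Perm (Fin (m + 1))) (τ : Equiv.Perm (Fin m))
    (x : Fin (m + 1) → X) (y : Fin m → X) :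
    comb m x y = (((Equiv.Perm.sign σ : ℤ) : ℂ) * ((Equiv.Perm.sign τ : ℤ) : ℂ)) •
      comb m (fun i => x (σ i)) (fun j => y (τ j)) := by
  unfold comb
  rw [LAnKe.antisymm σ (fun i => ι m (x i)), MultilinearMap.cons_smul, mul_smul]
  congr 1
  -- `τ` extended to fix the leading slot, which holds the inner bracket; its sign is unchanged.
  rw [LAnKe.antisymm (Equiv.Perm.decomposeFin.symm (0, τ)), Equiv.Perm.decomposeFin.symm_sign]
  simp only [if_true, one_mul]
  congr 2
  ext1 j
  refine Fin.cases ?_ (fun k => ?_) j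
  · simp
  · simp

theorem bracket_jacobi_apply {m : ℕ} {X K : Type*} [AddCommGroup K] [Module ℂ K] [LAnKe m K]
    (f : X → K) (x : Fin (m + 1) → X) (y : Fin m → X) :
    LAnKe.bracket (Fin.cons (LAnKe.bracket fun i => f (x i)) (fun j => f (y j)) :
      Fin (m + 1) → K) = ∑ i : Fin (m + 1), (-1 : ℂ) ^ (m - (i : ℕ)) •
      LAnKe.bracket (Fin.cons
        (LAnKe.bracket fun k => f ((Fin.snoc y (x i) : Fin (m + 1) → X) k))
        (fun j => f (x (i.succAbove j))) : Fin (m + 1) → K) := by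
  have h : ∀ i, (fun k => f ((Fin.snoc y (x i) : Fin (m + 1) → X) k)) =
      Fin.snoc (fun j => f (y j)) (f (x i)) := fun i => by
    ext1 k
    refine Fin.lastCases ?_ (fun k => ?_) k <;> simp
  simp only [h]
  exact LAnKe.jacobi (fun i => f (x i)) (fun j => f (y j))

theorem comb_jacobi {m : ℕ} {X : Type*} (x : Fin (m + 1) → X) (y : Fin m → X) :
    comb m x y = ∑ i : Fin (m + 1), (-1 : ℂ) ^ (m - (i : ℕ)) •
      comb m (Fin.snoc y (x i) : Fin (m + 1) → X) (fun j => x (i.succAbove j)) :=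
  bracket_jacobi_apply (ι m) x y

/-- The sign of an arrangement of the generators in two columns. -/
noncomputable def arrangementSign {m : ℕ} (e : Fin (m + 1) ⊕ Fin m ≃ Fin (2 * m + 1)) : ℂ :=
  ((Equiv.Perm.sign (e.trans ((finCongr (by omega)).trans finSumFinEquiv.symm)) : ℤ) : ℂ)

theorem arrangementSign_sq {m : ℕ} (e : Fin (m + 1) ⊕ Fin m ≃ Fin (2 * m + 1)) :
    arrangementSign e * arrangementSign e = 1 := int_sign_sq _

theorem arrangementSign_trans {m : ℕ} (π : Equiv.Perm (Fin (m + 1) ⊕ Fin m))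
    (e : Fin (m + 1) ⊕ Fin m ≃ Fin (2 * m + 1)) :
    arrangementSign (π.trans e) = arrangementSign e * ((Equiv.Perm.sign π : ℤ) : ℂ) := by
  unfold arrangementSign
  rw [Equiv.trans_assoc, Equiv.Perm.sign_trans]
  push_cast
  rfl

/-- The bracket of an arrangement of the generators, multiplied by its sign. -/
noncomputable def signedComb {m : ℕ} (e : Fin (m + 1) ⊕ Fin m ≃ Fin (2 * m + 1)) :
    FreeLAnKe m (Fin (2 * m + 1)) :=
  arrangementSign e • comb m (fun i => e (Sum.inl i)) (fun j => e (Sum.inr j))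

theorem comb_eq_smul_signedComb {m : ℕ} (e : Fin (m + 1) ⊕ Fin m ≃ Fin (2 * m + 1)) :
    comb m (fun i => e (Sum.inl i)) (fun j => e (Sum.inr j)) =
      arrangementSign e • signedComb e := by
  rw [signedComb, smul_smul, arrangementSign_sq, one_smul]

theorem signedComb_sumCongr {m : ℕ} (σ : Equiv.Perm (Fin (m + 1))) (τ : Equiv.Perm (Fin m))
    (e : Fin (m + 1) ⊕ Fin m ≃ Fin (2 * m + 1)) :
    signedComb ((Equiv.Perm.sumCongr σ τ).trans e) = signedComb e := by
  unfold signedComb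
  rw [comb_perm σ τ (fun i => e (Sum.inl i)), arrangementSign_trans, smul_smul,
    Equiv.Perm.sign_sumCongr]
  push_cast
  rfl

/-- The set of entries of the second column. -/
def outerSet {m : ℕ} (e : Fin (m + 1) ⊕ Fin m ≃ Fin (2 * m + 1)) : Finset (Fin (2 * m + 1)) :=
  Finset.univ.image (fun j => e (Sum.inr j))

theorem inr_mem_outerSet {m : ℕ} (e : Fin (m + 1) ⊕ Fin m ≃ Fin (2 * m + 1)) (j : Fin m) :
    e (Sum.inr j) ∈ outerSet e := Finset.mem_image_of_mem _ (Finset.mem_univ j)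

theorem inl_notMem_outerSet {m : ℕ} (e : Fin (m + 1) ⊕ Fin m ≃ Fin (2 * m + 1))
    (i : Fin (m + 1)) : e (Sum.inl i) ∉ outerSet e := by
  simp [outerSet]

theorem card_outerSet {m : ℕ} (e : Fin (m + 1) ⊕ Fin m ≃ Fin (2 * m + 1)) :
    (outerSet e).card = m := by
  have h := Finset.card_image_of_injective Finset.univ
    (e.injective.comp (Sum.inr_injective (α := Fin (m + 1)) (β := Fin m)))
  exact h.trans (by simp)

/-- Two arrangements with the same outer set differ by permutations within the columns, where the
arrangement sign cancels the sign from antisymmetry. -/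
theorem signedComb_eq_of_outerSet_eq {m : ℕ} {e e' : Fin (m + 1) ⊕ Fin m ≃ Fin (2 * m + 1)}
    (h : outerSet e = outerSet e') : signedComb e = signedComb e' := by
  have hmap : Set.MapsTo (e.trans e'.symm) (Set.range Sum.inl) (Set.range Sum.inl) := by
    rintro _ ⟨i, rfl⟩
    have hi := inl_notMem_outerSet e i
    rw [h] at hi
    obtain ⟨k | k, hk⟩ := e'.surjective (e (Sum.inl i))
    · exact ⟨k, by simp [← hk]⟩
    · exact absurd (hk ▸ inr_mem_outerSet e' k) hi
  obtain ⟨⟨σ, τ⟩, hστ⟩ := Equiv.Perm.mem_sumCongrHom_range_of_perm_mapsTo_inl hmap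
  have : e = (Equiv.Perm.sumCongr σ τ).trans e' := by
    have h2 : Equiv.Perm.sumCongr σ τ = e.trans e'.symm := hστ
    rw [h2, Equiv.trans_assoc, Equiv.symm_trans_self, Equiv.trans_refl]
  rw [this, signedComb_sumCongr]

open Classical in
/-- The signed bracket as a function of the set of entries of the second column. -/
noncomputable def setComb (m : ℕ) (T : Finset (Fin (2 * m + 1))) : FreeLAnKe m (Fin (2 * m + 1)) :=
  if h : ∃ e : Fin (m + 1) ⊕ Fin m ≃ Fin (2 * m + 1), outerSet e = T then signedComb h.choose
  else 0

theorem setComb_outerSet {m : ℕ} (e : Fin (m + 1) ⊕ Fin m ≃ Fin (2 * m + 1)) :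
    setComb m (outerSet e) = signedComb e := by
  have h : ∃ e' : Fin (m + 1) ⊕ Fin m ≃ Fin (2 * m + 1), outerSet e' = outerSet e := ⟨e, rfl⟩
  rw [setComb, dif_pos h]
  exact signedComb_eq_of_outerSet_eq h.choose_spec

/-- The exchange of the second column with the first one without its last entry. -/
def columnSwap (m : ℕ) : Equiv.Perm (Fin (m + 1) ⊕ Fin m) :=
  Function.Involutive.toPerm
    (Sum.elim (Fin.lastCases (Sum.inl (Fin.last m)) Sum.inr) (fun k => Sum.inl k.castSucc)) <| by
      rintro (i | k)
      · refine Fin.lastCases ?_ (fun k => ?_) i <;> simp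
      · simp

theorem columnSwap_inl_last (m : ℕ) :
    columnSwap m (Sum.inl (Fin.last m)) = Sum.inl (Fin.last m) := by
  change Fin.lastCases (motive := fun _ => Fin (m + 1) ⊕ Fin m) _ _ _ = _
  simp

theorem columnSwap_inl_castSucc {m : ℕ} (k : Fin m) :
    columnSwap m (Sum.inl k.castSucc) = Sum.inr k := by
  change Fin.lastCases (motive := fun _ => Fin (m + 1) ⊕ Fin m) _ _ _ = _
  simp

/-- The permutation which moves the `i`-th entry of a column to its end. -/
def moveToEnd {m : ℕ} (i : Fin (m + 1)) : Equiv.Perm (Fin (m + 1)) :=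
  (finRotate (m + 1)).trans i.cycleRange.symm

theorem moveToEnd_last {m : ℕ} (i : Fin (m + 1)) : moveToEnd i (Fin.last m) = i := by
  simp [moveToEnd]

theorem moveToEnd_castSucc {m : ℕ} (i : Fin (m + 1)) (k : Fin m) :
    moveToEnd i k.castSucc = i.succAbove k := by
  simp [moveToEnd]

theorem sign_moveToEnd {m : ℕ} (i : Fin (m + 1)) :
    ((Equiv.Perm.sign (moveToEnd i) : ℤ) : ℂ) = (-1) ^ (m - (i : ℕ)) := by
  rw [moveToEnd, Equiv.Perm.sign_trans, sign_finRotate, Equiv.Perm.sign_symm, Fin.sign_cycleRange]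
  push_cast
  rw [← pow_add, show (i : ℕ) + m = m - i + 2 * i by omega, pow_add, pow_mul]
  simp

/-- The rearrangement of the columns in the `i`-th term of the Jacobi identity. -/
def jacobiPerm {m : ℕ} (i : Fin (m + 1)) : Equiv.Perm (Fin (m + 1) ⊕ Fin m) :=
  (columnSwap m).trans (Equiv.Perm.sumCongr (moveToEnd i) 1)

theorem jacobiPerm_inl_last {m : ℕ} (i : Fin (m + 1)) :
    jacobiPerm i (Sum.inl (Fin.last m)) = Sum.inl i := by
  simp [jacobiPerm, columnSwap_inl_last, moveToEnd_last]

theorem jacobiPerm_inl_castSucc {m : ℕ} (i : Fin (m + 1)) (k : Fin m) :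
    jacobiPerm i (Sum.inl k.castSucc) = Sum.inr k := by
  simp [jacobiPerm, columnSwap_inl_castSucc]

theorem jacobiPerm_inr {m : ℕ} (i : Fin (m + 1)) (k : Fin m) :
    jacobiPerm i (Sum.inr k) = Sum.inl (i.succAbove k) :=
  congrArg Sum.inl (moveToEnd_castSucc i k)

theorem sign_jacobiPerm {m : ℕ} (i : Fin (m + 1)) :
    ((Equiv.Perm.sign (jacobiPerm i) : ℤ) : ℂ) =
      (-1) ^ (m - (i : ℕ)) * ((Equiv.Perm.sign (columnSwap m) : ℤ) : ℂ) := by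
  rw [jacobiPerm, Equiv.Perm.sign_trans, Equiv.Perm.sign_sumCongr, ← sign_moveToEnd]
  simp

/-- The Jacobi sign `(-1) ^ (m - i)` is absorbed by the sign of `moveToEnd i`, leaving one sign,
that of `columnSwap m`, common to all terms. Only its being `±1` matters later. -/
theorem signedComb_exchange {m : ℕ} (e : Fin (m + 1) ⊕ Fin m ≃ Fin (2 * m + 1)) :
    signedComb e = ((Equiv.Perm.sign (columnSwap m) : ℤ) : ℂ) •
      ∑ i, signedComb ((jacobiPerm i).trans e) := by
  have h : ∀ i, comb m (fun k => (jacobiPerm i).trans e (Sum.inl k))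
      (fun k => (jacobiPerm i).trans e (Sum.inr k)) =
      comb m (Fin.snoc (fun j => e (Sum.inr j)) (e (Sum.inl i)) : Fin (m + 1) → _)
        (fun k => e (Sum.inl (i.succAbove k))) := fun i => by
    refine congrArg₂ (comb m) (funext fun k => ?_) (funext fun k => ?_)
    · refine Fin.lastCases ?_ (fun k => ?_) k
      · simp [jacobiPerm_inl_last]
      · simp [jacobiPerm_inl_castSucc]
    · simp [jacobiPerm_inr]
  have hs : ∀ i : Fin (m + 1), arrangementSign e * (-1) ^ (m - (i : ℕ)) =
      ((Equiv.Perm.sign (columnSwap m) : ℤ) : ℂ) * arrangementSign ((jacobiPerm i).trans e) :=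
    fun i => by
      rw [arrangementSign_trans, sign_jacobiPerm]
      linear_combination (-arrangementSign e * (-1) ^ (m - (i : ℕ))) * int_sign_sq (columnSwap m)
  simp only [signedComb, h]
  rw [comb_jacobi, Finset.smul_sum, Finset.smul_sum]
  exact Finset.sum_congr rfl fun i _ => by rw [smul_smul, smul_smul, hs]

theorem compl_outerSet {m : ℕ} (e : Fin (m + 1) ⊕ Fin m ≃ Fin (2 * m + 1)) :
    (outerSet e)ᶜ = Finset.univ.image (fun i => e (Sum.inl i)) := by
  ext a
  obtain ⟨i | j, rfl⟩ := e.surjective a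
  · simp [inl_notMem_outerSet]
  · simp [inr_mem_outerSet]

theorem outerSet_jacobiPerm {m : ℕ} (e : Fin (m + 1) ⊕ Fin m ≃ Fin (2 * m + 1))
    (i : Fin (m + 1)) :
    outerSet ((jacobiPerm i).trans e) = (outerSet e)ᶜ.erase (e (Sum.inl i)) := by
  rw [compl_outerSet]
  ext a
  simp only [outerSet, Equiv.trans_apply, jacobiPerm_inr, Finset.mem_image, Finset.mem_univ,
    true_and, Finset.mem_erase]
  constructor
  · rintro ⟨k, rfl⟩
    exact ⟨by simp, _, rfl⟩
  · rintro ⟨h, k, rfl⟩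
    obtain ⟨l, hl⟩ := Fin.exists_succAbove_eq (x := k) (y := i) (fun hk => h (hk ▸ rfl))
    exact ⟨l, by rw [hl]⟩

theorem exists_outerSet_eq {m : ℕ} (T : Finset (Fin (2 * m + 1))) (hT : T.card = m) :
    ∃ e : Fin (m + 1) ⊕ Fin m ≃ Fin (2 * m + 1), outerSet e = T := by
  have h1 : Tᶜ.card = m + 1 := by rw [Finset.card_compl, Fintype.card_fin]; omega
  have h2 : Tᶜᶜ.card = m := by rwa [compl_compl]
  refine ⟨finSumEquivOfFinset h1 h2, Finset.eq_of_subset_of_card_le ?_ ?_⟩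
  · intro a ha
    obtain ⟨j, -, rfl⟩ := Finset.mem_image.1 ha
    rw [finSumEquivOfFinset_inr]
    exact (compl_compl T).subset (Finset.orderEmbOfFin_mem _ h2 j)
  · rw [card_outerSet, hT]

theorem setComb_exchange {m : ℕ} (T : Finset (Fin (2 * m + 1))) (hT : T.card = m) :
    setComb m T = ((Equiv.Perm.sign (columnSwap m) : ℤ) : ℂ) •
      ∑ i ∈ Tᶜ, setComb m (Tᶜ.erase i) := by
  obtain ⟨e, rfl⟩ := exists_outerSet_eq T hT
  rw [setComb_outerSet, signedComb_exchange]
  conv_rhs => rw [compl_outerSet, Finset.sum_image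
    (fun i _ j _ h => Sum.inl_injective (e.injective h)), ← compl_outerSet]
  simp only [← outerSet_jacobiPerm, setComb_outerSet]

theorem comb_mem_span_isStandard {m : ℕ} (x : Fin (m + 1) → Fin (2 * m + 1))
    (y : Fin m → Fin (2 * m + 1)) (h : Function.Bijective (Sum.elim x y)) :
    comb m x y ∈ Submodule.span ℂ
      (Set.range fun p : {p // IsStandard m p} => comb m p.1.1 p.1.2) := by
  set S := Submodule.span ℂ (Set.range fun p : {p // IsStandard m p} => comb m p.1.1 p.1.2)
  set e := Equiv.ofBijective _ h
  have hxy : comb m x y = arrangementSign e • signedComb e := comb_eq_smul_signedComb e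
  rw [hxy, ← setComb_outerSet]
  refine S.smul_mem _ (straightening (setComb m) _ ?_ setComb_exchange S ?_ _ ?_)
  · rcases Int.units_eq_one_or (Equiv.Perm.sign (columnSwap m)) with h | h <;> simp [h]
  · intro p hp
    have := setComb_outerSet (Equiv.ofBijective _ hp.each_once)
    rw [show Finset.univ.image p.2 = outerSet (Equiv.ofBijective _ hp.each_once) from rfl, this]
    exact S.smul_mem _ (Submodule.subset_span ⟨⟨p, hp⟩, rfl⟩)
  · exact card_outerSet e

/-! ### Words with two brackets and the span of the standard brackets. -/

namespace Word

variable {m : ℕ} {X : Type*}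

/-- The word of the bracket `[[x₁,…,xₙ],y₁,…,yₙ₋₁]`. -/
def nested (x : Fin (m + 1) → X) (y : Fin m → X) : Fin (m + 1) → Word m X :=
  Fin.cons (node fun i => gen (x i)) (fun j => gen (y j))

theorem eval_node_nested (x : Fin (m + 1) → X) (y : Fin m → X) :
    (node (nested x y)).eval (ι m) = comb m x y := by
  rw [eval, comb]
  congr 1
  ext1 i
  refine Fin.cases ?_ (fun k => ?_) i <;> simp [nested, eval]

theorem brackets_node_nested (x : Fin (m + 1) → X) (y : Fin m → X) :
    (node (nested x y)).brackets = 2 := by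
  simp [nested, brackets, Fin.sum_univ_succ]

theorem count_node_nested [DecidableEq X] (x : Fin (m + 1) → X) (y : Fin m → X) (a : X) :
    (node (nested x y)).count a = (Finset.univ.filter fun s => Sum.elim x y s = a).card := by
  rw [Finset.card_filter, Fintype.sum_sum_type, count, Fin.sum_univ_succ]
  simp only [nested, Fin.cons_zero, Fin.cons_succ, count, Sum.elim_inl, Sum.elim_inr]
  rfl

theorem count_node_nested_eq_one_iff [DecidableEq X] (x : Fin (m + 1) → X) (y : Fin m → X) :
    (∀ a, (node (nested x y)).count a = 1) ↔ Function.Bijective (Sum.elim x y) := by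
  rw [Function.bijective_iff_existsUnique]
  refine forall_congr' fun a => ?_
  rw [count_node_nested, Finset.card_eq_one, Finset.singleton_iff_unique_mem]
  simp only [Finset.mem_filter_univ]

theorem eq_gen_of_brackets_eq_zero : ∀ w : Word m X, w.brackets = 0 → ∃ a, w = gen a
  | gen a, _ => ⟨a, rfl⟩
  | node w, h => by simp [brackets] at h

theorem eq_node_of_brackets_eq_one : ∀ w : Word m X, w.brackets = 1 →
    ∃ x : Fin (m + 1) → X, w = node fun i => gen (x i)
  | gen a, h => by simp [brackets] at h
  | node w, h => by
    have h0 : ∀ i, (w i).brackets = 0 := by simpa [brackets] using h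
    choose x hx using fun i => eq_gen_of_brackets_eq_zero (w i) (h0 i)
    exact ⟨x, congrArg node (funext hx)⟩

theorem eq_node_of_brackets_eq_two : ∀ w : Word m X, w.brackets = 2 →
    ∃ (σ : Equiv.Perm (Fin (m + 1))) (x : Fin (m + 1) → X) (y : Fin m → X),
      w = node fun i => nested x y (σ i)
  | gen a, h => by simp [brackets] at h
  | node w, h => by
    have h1 : ∑ i, (w i).brackets = 1 := by rw [brackets] at h; omega
    -- Exactly one entry is a bracket and the others are generators; the transposition of `0` and
    -- `i` brings it to the front.
    obtain ⟨i, -, hi⟩ := Finset.exists_ne_zero_of_sum_ne_zero (h1.symm ▸ one_ne_zero)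
    rw [← Finset.add_sum_erase _ _ (Finset.mem_univ i)] at h1
    have h2 : ∀ j ∈ Finset.univ.erase i, (w j).brackets = 0 := Finset.sum_eq_zero_iff.1 (by omega)
    obtain ⟨x, hx⟩ := eq_node_of_brackets_eq_one (w i) (by omega)
    have h3 : ∀ j : Fin m, Equiv.swap 0 i j.succ ≠ i := fun j hj => by
      rw [Equiv.swap_apply_eq_iff, Equiv.swap_apply_right] at hj
      exact Fin.succ_ne_zero j hj
    choose y hy using fun j : Fin m => eq_gen_of_brackets_eq_zero (w (Equiv.swap 0 i j.succ))
      (h2 _ (Finset.mem_erase.2 ⟨h3 j, Finset.mem_univ _⟩))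
    refine ⟨Equiv.swap 0 i, x, y, congrArg node ?_⟩
    have h4 : ∀ k, w (Equiv.swap 0 i k) = nested x y k := fun k => by
      refine Fin.cases ?_ (fun j => ?_) k
      · simp [nested, hx]
      · simp [nested, hy]
    ext1 k
    rw [← h4, Equiv.swap_apply_self]

end Word

theorem rho3_eq_span (m : ℕ) : rho3 m = Submodule.span ℂ
    (Set.range fun p : {p // IsStandard m p} => comb m p.1.1 p.1.2) := by
  refine le_antisymm (Submodule.span_le.2 ?_) (Submodule.span_le.2 ?_)
  · rintro _ ⟨w, hw, hc, rfl⟩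
    obtain ⟨σ, x, y, rfl⟩ := w.eq_node_of_brackets_eq_two hw
    have hb : Function.Bijective (Sum.elim x y) := by
      rw [← Word.count_node_nested_eq_one_iff]
      intro a
      refine Eq.trans ?_ (hc a)
      rw [Word.count, Word.count, Equiv.sum_comp σ (fun i => (Word.nested x y i).count a)]
    have he : (Word.node fun i => Word.nested x y (σ i)).eval (ι m) =
        ((Equiv.Perm.sign σ : ℤ) : ℂ) • comb m x y := by
      rw [← Word.eval_node_nested, Word.eval, Word.eval,
        LAnKe.antisymm σ (fun i => (Word.nested x y i).eval (ι m)), smul_smul, int_sign_sq,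
        one_smul]
    rw [he]
    exact Submodule.smul_mem _ _ (comb_mem_span_isStandard x y hb)
  · rintro _ ⟨p, rfl⟩
    refine Submodule.subset_span ⟨Word.node (Word.nested p.1.1 p.1.2),
      Word.brackets_node_nested _ _, ?_, (Word.eval_node_nested _ _).symm⟩
    rw [Word.count_node_nested_eq_one_iff]
    exact p.2.each_once

theorem exists_basis_rho3 (m : ℕ) : ∃ b : Module.Basis {p // IsStandard m p} ℂ (rho3 m),
    ∀ p, (b p : FreeLAnKe m (Fin (2 * m + 1))) = comb m p.1.1 p.1.2 := by
  refine ⟨(Module.Basis.span (linearIndependent_comb m)).map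
    (LinearEquiv.ofEq _ _ (rho3_eq_span m).symm), fun p => ?_⟩
  rw [Module.Basis.map_apply, LinearEquiv.coe_ofEq_apply, Module.Basis.span_apply]

/-! ### Standard brackets and standard tableaux. -/

variable {m : ℕ}

/-- The position of an entry of the first column. -/
def innerCell (i : Fin (m + 1)) : {c : ℕ × ℕ // c ∈ shape m} :=
  ⟨(i, 0), mem_shape.2 (Or.inl ⟨rfl, i.2⟩)⟩

/-- The position of an entry of the second column. -/
def outerCell (j : Fin m) : {c : ℕ × ℕ // c ∈ shape m} :=
  ⟨(j, 1), mem_shape.2 (Or.inr ⟨rfl, j.2⟩)⟩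

theorem bijective_cell : Function.Bijective (Sum.elim (innerCell (m := m)) outerCell) := by
  constructor
  · rintro (i | i) (j | j) h
    · exact congrArg _ (Fin.ext (congrArg (fun c => c.1.1) h))
    · exact absurd (congrArg (fun c => c.1.2) h) Nat.zero_ne_one
    · exact absurd (congrArg (fun c => c.1.2) h) Nat.one_ne_zero
    · exact congrArg _ (Fin.ext (congrArg (fun c => c.1.1) h))
  · rintro ⟨⟨r, c⟩, h⟩
    rcases mem_shape.1 h with ⟨h1, h2⟩ | ⟨h1, h2⟩
    · exact ⟨Sum.inl ⟨r, h2⟩, Subtype.ext (Prod.ext rfl h1.symm)⟩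
    · exact ⟨Sum.inr ⟨r, h2⟩, Subtype.ext (Prod.ext rfl h1.symm)⟩

theorem tableau_comp_cell (p : (Fin (m + 1) → Fin (2 * m + 1)) × (Fin m → Fin (2 * m + 1))) :
    tableau m p ∘ Sum.elim innerCell outerCell = Sum.elim p.1 p.2 := by
  ext1 s
  rcases s with i | j <;> rfl

theorem isStandardTableau_tableau_iff
    (p : (Fin (m + 1) → Fin (2 * m + 1)) × (Fin m → Fin (2 * m + 1))) :
    IsStandardTableau (shape m) (tableau m p) ↔ IsStandard m p := by
  have hb : Function.Bijective (tableau m p) ↔ Function.Bijective (Sum.elim p.1 p.2) := by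
    rw [← tableau_comp_cell, Function.Bijective.of_comp_iff _ bijective_cell]
  constructor
  · intro h
    refine ⟨hb.1 h.bijective, fun i j hij => ?_, fun i j hij => ?_, fun j => ?_⟩
    · exact h.col_increasing (innerCell i) (innerCell j) rfl hij
    · exact h.col_increasing (outerCell i) (outerCell j) rfl hij
    · exact h.row_increasing (innerCell j.castSucc) (outerCell j) rfl Nat.zero_lt_one
  · intro h
    refine ⟨hb.2 h.each_once, fun c d => ?_, fun c d => ?_⟩ <;>
      obtain ⟨i | i, rfl⟩ := bijective_cell.2 c <;> obtain ⟨j | j, rfl⟩ := bijective_cell.2 d <;>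
      intro h1 h2
    · exact absurd h2 (lt_irrefl _)
    -- An inner and an outer cell in the same row: the only case where row growth says anything,
    -- since rows have length at most two.
    · obtain rfl : i = j.castSucc := Fin.ext h1
      exact h.inner_lt_outer j
    · exact absurd h2 (by simp [innerCell, outerCell])
    · exact absurd h2 (lt_irrefl _)
    · exact h.inner_increasing h2
    · exact absurd h1 Nat.zero_ne_one
    · exact absurd h1 Nat.one_ne_zero
    · exact h.outer_increasing h2

theorem bijective_tableau (m : ℕ) : Function.Bijective (tableau m) := by
  constructor
  · intro p q h
    refine Prod.ext (funext fun i => ?_) (funext fun j => ?_)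
    · exact congrFun h (innerCell i)
    · exact congrFun h (outerCell j)
  · intro t
    refine ⟨(fun i => t (innerCell i), fun j => t (outerCell j)), ?_⟩
    ext1 c
    obtain ⟨i | j, rfl⟩ := bijective_cell.2 c <;> rfl

theorem bijOn_tableau (m : ℕ) : Set.BijOn (tableau m) {p | IsStandard m p}
    {t | IsStandardTableau (shape m) t} := by
  refine ⟨fun p hp => (isStandardTableau_tableau_iff p).2 hp, (bijective_tableau m).1.injOn,
    fun t ht => ?_⟩
  obtain ⟨p, rfl⟩ := (bijective_tableau m).2 t
  exact ⟨p, (isStandardTableau_tableau_iff p).1 ht, rfl⟩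

end LieNth

theorem corollary3p4 (m : ℕ) :
    (∃ b : Module.Basis {p // LieNth.IsStandard m p} ℂ (LieNth.rho3 m),
      ∀ p, (b p : LieNth.FreeLAnKe m (Fin (2 * m + 1))) = LieNth.comb m p.1.1 p.1.2) ∧
    Set.BijOn (LieNth.tableau m) {p | LieNth.IsStandard m p}
      {t | LieNth.IsStandardTableau (LieNth.shape m) t} :=
  ⟨LieNth.exists_basis_rho3 m, LieNth.bijOn_tableau m⟩
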